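/- **Notation.** For a closed set $S\subseteq\mathbb{R}^d$ let $\pi_S(x)$ be the set of points of $S$ closest to $x$, and let $\operatorname{ax}(S)=\{x : \#\pi_S(x)>1\}$ be its medial axis. For $p\in S$ and $v\in\mathbb{R}^d$ put $d(p,v,\pi_S)=\sup\{\lambda\in\mathbb{R} : \pi_S(p+\lambda v)=\{p\}\}\in[0,\infty]$, and let $\operatorname{UBP}(S)$ be the set of pairs $(p,u)$ with $p\in S$, $|u|=1$ and $0<d(p,u,\pi_S)<\infty$. For $(p,u)\in \operatorname{UBP}(S)$ put $\pi_{\operatorname{ax},S}(p,u)=p+d(p,u,\pi_S)\,u$. Let $\operatorname{Tan}(p,S)$ consist of $0$ and of all $u\ne 0$ such that for every $\varepsilon>0$ there is $q\in S$ with $0<|q-p|<\varepsilon$ and $\left|\frac{q-p}{|q-p|}-\frac{u}{|u|}\right|<\varepsilon$, and let $\operatorname{Nor}(p,S)=\{v : \langle v,u\rangle\le 0\ \text{for all } u\in\operatorname{Tan}(p,S)\}$. A closed ball $B(c,\rho)$ is weakly tangent to $S$ at $p\in S$ if $c-p\in\operatorname{Nor}(p,S)$ and $\rho=|c-p|$.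 It is a maximal empty weakly tangent ball to $S$ at $p$ with internal normal $u$ if moreover $(p,u)\in\operatorname{UBP}(S)$, $\rho=d(p,u,\pi_S)$ and $c=p+\rho u$. The Hausdorff distance is $d_H$, with values in $[0,\infty]$; $|\cdot|$ is the Euclidean norm and $\|\cdot\|$ the operator norm. **Theorem.** Let $S\subseteq\mathbb{R}^d$ be a closed set contained in a closed ball of radius $r>0$ whose boundary sphere $S(r)$ is contained in $S$. Let $F:\mathbb{R}^d\to\mathbb{R}^d$ be a $C^1$ diffeomorphism such that $F$ and $F^{-1}$ are Lipschitz with constant $L_F$, the differentials $DF$ and $D(F^{-1})$ are Lipschitz with constant $L_{DF}$, and $F(S(r))=S(r)$. (1) Let $c\in\operatorname{ax}(S)$, $p\in\pi_S(c)$, $\rho=|c-p|$, $u=\frac{c-p}{|c-p|}$, $T=u^\perp$ and $$u'=\frac{(D_pF^t)^{-1}u}{|(D_pF^t)^{-1}u|}.$$ Then $B(c,\rho)$ is a maximal empty weakly tangent ball to $S$ at $p$ with internal normal $u$. The vector $u'$ is a unit vector, $D_pF(T)=u'^\perp$, and $u'$ points at $F(p)$ into the image of the ball, that is, $F(p)+tu'$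 lies in the image under $F$ of the open ball with centre $c$ and radius $\rho$ for all sufficiently small $t>0$. There is a maximal empty weakly tangent ball $B(c',\rho')$ to $F(S)$ at $F(p)$ with internal normal $u'$. It is tangent to the affine subspace $F(p)+D_pF(T)$, meeting it only in $F(p)$. Its radius satisfies $$\rho'\ge\frac{\rho}{L_F^3+\rho L_{DF}L_F^2},\qquad\text{and}\qquad \rho'\le\frac{L_F^3\rho}{1-\rho L_{DF}L_F^2}\quad\text{if }\rho L_{DF}L_F^2<1.$$ (2) Suppose moreover that $|F(x)-x|\le\varepsilon_1$ and $\|D_xF-\operatorname{Id}\|\le\varepsilon_2<1$ for all $x\in\mathbb{R}^d$, and that $r L_{DF}L_F^2\le 1/2$. Put $$\Delta=2r\sqrt{1+L_F^6\left(1+4rL_{DF}L_F^2\right)^2-2L_F^3\left(1+4rL_{DF}L_F^2\right)\sqrt{1-\varepsilon_2^2}}+\varepsilon_1.$$ Then, for all $c,p,u,u'$ as in (1), $$\left|\pi_{\operatorname{ax},S}(p,u)-\pi_{\operatorname{ax},F(S)}(F(p),u')\right|\le\Delta,$$ and $$d_H\left(\operatorname{ax}(S),\operatorname{ax}(F(S))\right)\le\Delta,\qquad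 d_H\left(\overline{\operatorname{ax}(S)},\overline{\operatorname{ax}(F(S))}\right)\le\Delta.$$ -/

import Mathlib

open Set Filter Topology Metric
open scoped NNReal ENNReal InnerProductSpace

/-- The set of points of `S` closest to `x`. -/
def closestPoints {d : ℕ} (S : Set (EuclideanSpace ℝ (Fin d))) (x : EuclideanSpace ℝ (Fin d)) :
    Set (EuclideanSpace ℝ (Fin d)) :=
  {q | q ∈ S ∧ dist x q = infDist x S}

/-- The medial axis: the points with more than one closest point in `S`. -/
def medialAxis {d : ℕ} (S : Set (EuclideanSpace ℝ (Fin d))) : Set (EuclideanSpace ℝ (Fin d)) :=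
  {x | (closestPoints S x).Nontrivial}

/-- The projection range of `S` at `p` in the direction `v`, an extended real number. -/
noncomputable def projectionRange {d : ℕ} (S : Set (EuclideanSpace ℝ (Fin d)))
    (p v : EuclideanSpace ℝ (Fin d)) : EReal :=
  sSup ((fun t : ℝ => (t : EReal)) '' {t : ℝ | closestPoints S (p + t • v) = {p}})

/-- The pairs `(p, u)` of a point `p` of `S` and a unit back projection vector `u` of `S` at `p`. -/
def UBP {d : ℕ} (S : Set (EuclideanSpace ℝ (Fin d))) :
    Set (EuclideanSpace ℝ (Fin d) × EuclideanSpace ℝ (Fin d)) :=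
  {x | x.1 ∈ S ∧ ‖x.2‖ = 1 ∧ 0 < projectionRange S x.1 x.2 ∧ projectionRange S x.1 x.2 < ⊤}

/-- The map `(p, u) ↦ p + d(p, u, π_S) u`; meaningful for `(p, u) ∈ UBP S`, where the projection
range is finite. -/
noncomputable def axisProjection {d : ℕ} (S : Set (EuclideanSpace ℝ (Fin d)))
    (p u : EuclideanSpace ℝ (Fin d)) : EuclideanSpace ℝ (Fin d) :=
  p + (projectionRange S p u).toReal • u

/-- The generalized tangent space of `S` at `p`. -/
def generalizedTangent {d : ℕ} (S : Set (EuclideanSpace ℝ (Fin d)))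
    (p : EuclideanSpace ℝ (Fin d)) : Set (EuclideanSpace ℝ (Fin d)) :=
  {u | u = 0 ∨ ∀ ε : ℝ, 0 < ε → ∃ q ∈ S, 0 < ‖q - p‖ ∧ ‖q - p‖ < ε ∧
    ‖‖q - p‖⁻¹ • (q - p) - ‖u‖⁻¹ • u‖ < ε}

/-- The generalized normal space of `S` at `p`. -/
def generalizedNormal {d : ℕ} (S : Set (EuclideanSpace ℝ (Fin d)))
    (p : EuclideanSpace ℝ (Fin d)) : Set (EuclideanSpace ℝ (Fin d)) :=
  {v | ∀ u ∈ generalizedTangent S p, ⟪v, u⟫_ℝ ≤ 0}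

/-- The ball with centre `c` and radius `ρ` is weakly tangent to `S` at `p`. -/
def IsWeaklyTangentBall {d : ℕ} (S : Set (EuclideanSpace ℝ (Fin d)))
    (p c : EuclideanSpace ℝ (Fin d)) (ρ : ℝ) : Prop :=
  p ∈ S ∧ c - p ∈ generalizedNormal S p ∧ ρ = ‖c - p‖

/-- The ball with centre `c` and radius `ρ` is a maximal empty weakly tangent ball to `S` at `p`,
and the boundary sphere has the internal unit normal `u` at `p`. -/
structure IsMaximalEmptyBall {d : ℕ} (S : Set (EuclideanSpace ℝ (Fin d)))
    (p u c : EuclideanSpace ℝ (Fin d)) (ρ : ℝ) : Prop where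
  mem_UBP : (p, u) ∈ UBP S
  weaklyTangent : IsWeaklyTangentBall S p c ρ
  center_eq : c = p + ρ • u
  radius_eq : (ρ : EReal) = projectionRange S p u

/-- `F` is a `C^{1,1}` diffeomorphism of `ℝ^d`: `F` and its inverse are `C¹` and `LF`-Lipschitz,
and the differentials of `F` and of its inverse are `LDF`-Lipschitz for the operator norm. -/
structure IsC11Diffeo {d : ℕ} (F : EuclideanSpace ℝ (Fin d) ≃ EuclideanSpace ℝ (Fin d))
    (LF LDF : ℝ≥0) : Prop where
  contDiff : ContDiff ℝ 1 F
  contDiff_symm : ContDiff ℝ 1 F.symm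
  lipschitz : LipschitzWith LF F
  lipschitz_symm : LipschitzWith LF F.symm
  lipschitz_fderiv : LipschitzWith LDF (fderiv ℝ F)
  lipschitz_fderiv_symm : LipschitzWith LDF (fderiv ℝ F.symm)

/-- The vector `(D_pF^t)⁻¹ u / |(D_pF^t)⁻¹ u|`. -/
noncomputable def imageNormal {d : ℕ}
    (F : EuclideanSpace ℝ (Fin d) → EuclideanSpace ℝ (Fin d)) (p u : EuclideanSpace ℝ (Fin d)) :
    EuclideanSpace ℝ (Fin d) :=
  ‖(ContinuousLinearMap.adjoint (fderiv ℝ F p)).inverse u‖⁻¹ •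
    (ContinuousLinearMap.adjoint (fderiv ℝ F p)).inverse u

/-- The right-hand side of the distance estimates. -/
noncomputable def distortionBound (r LF LDF ε₁ ε₂ : ℝ) : ℝ :=
  2 * r * √(1 + LF ^ 6 * (1 + 4 * r * LDF * LF ^ 2) ^ 2
    - 2 * LF ^ 3 * (1 + 4 * r * LDF * LF ^ 2) * √(1 - ε₂ ^ 2)) + ε₁

/-!
A point `p` of `S` is closest to `p + R • u` exactly when `2 * R * ⟪s - p, u⟫ ≤ ‖s - p‖ ^ 2` for
all `s ∈ S`. A second-order Taylor bound for `F⁻¹` at `F p` carries this inequality over to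
`F '' S`, with the conormal `(D_pF^t)⁻¹ u` in place of `u`; this bounds the radius of the image
ball from below, and the same bound for `F⁻¹` bounds it from above. Empty balls that meet the
inside of the bounding sphere stay inside it, so all radii are at most `r`. Hence the two radii
are within a constant factor of each other, the angle between `u` and `u'` is controlled by
`‖D_pF - id‖`, and the law of cosines bounds the distance between the two centres.

The centre of a maximal empty ball need not lie on the medial axis, only in its closure: where the
closest point is unique, the distance to `S` grows at unit rate away from that point, so a ball
whose centre had a neighbourhood free of the medial axis could be enlarged. This suffices for the
Hausdorff distance, which does not distinguish a set from its closure.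
-/

theorem ne_zero_of_norm_eq_one {E : Type*} [NormedAddCommGroup E] {u : E} (hu : ‖u‖ = 1) :
    u ≠ 0 :=
  ne_zero_of_norm_ne_zero (hu.trans_ne one_ne_zero)

theorem nontrivial_of_norm_eq_one {E : Type*} [NormedAddCommGroup E] {u : E} (hu : ‖u‖ = 1) :
    Nontrivial E :=
  nontrivial_of_ne u 0 (ne_zero_of_norm_eq_one hu)

theorem infEDist_le_ofReal_of_mem_closure {X : Type*} [PseudoMetricSpace X] {A : Set X} {x y : X}
    {B : ℝ} (hy : y ∈ closure A) (h : dist x y ≤ B) : infEDist x A ≤ ENNReal.ofReal B := by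
  rw [← infEDist_closure]
  refine (infEDist_le_edist_of_mem hy).trans ?_
  rw [edist_dist]
  exact ENNReal.ofReal_le_ofReal h

section NormedSpace

variable {E G : Type*} [NormedAddCommGroup E] [NormedSpace ℝ E] [NormedAddCommGroup G]
  [NormedSpace ℝ G]

theorem dist_add_smul_self {u : E} (hu : ‖u‖ = 1) (p : E) {t : ℝ} (ht : 0 ≤ t) :
    dist (p + t • u) p = t := by
  rw [dist_self_add_left, norm_smul_of_nonneg ht, hu, mul_one]

theorem radius_le_of_ball_subset_ball [Nontrivial E] {c o : E} {ρ r : ℝ} (hρ : 0 < ρ)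
    (h : ball c ρ ⊆ ball o r) : ρ ≤ r := by
  have hr : 0 < r := nonempty_ball.1 ((nonempty_ball.2 hρ).mono h)
  have hdiam := diam_mono h isBounded_ball
  rw [diam_ball_eq c hρ.le, diam_ball_eq o hr.le] at hdiam
  linarith

theorem subset_ball_of_disjoint_sphere {X : Type*} [PseudoMetricSpace X] {U : Set X} {o : X} {r : ℝ}
    (hU : IsPreconnected U) (hdisj : Disjoint U (sphere o r)) (hne : (U ∩ ball o r).Nonempty) :
    U ⊆ ball o r := by
  refine hU.subset_of_closure_inter_subset isOpen_ball hne fun x ⟨hx, hxU⟩ => ?_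
  exact lt_of_le_of_ne (closure_ball_subset_closedBall hx) fun h => disjoint_left.1 hdisj hxU h

theorem eq_smul_of_add_le_norm_smul_add [StrictConvexSpace ℝ E] {u a : E} {ρ ε : ℝ}
    (hu : ‖u‖ = 1) (hρ : 0 < ρ) (ha : ‖a‖ ≤ ε) (h : ρ + ε ≤ ‖ρ • u + a‖) : a = ε • u := by
  have hρu : ‖ρ • u‖ = ρ := by rw [norm_smul_of_nonneg hρ.le, hu, mul_one]
  have htriangle := norm_add_le (ρ • u) a
  have hray : SameRay ℝ (ρ • u) a := by
    rw [sameRay_iff_norm_add]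
    linarith
  have hsmul := hray.norm_smul_eq
  rw [hρu, smul_comm, show ‖a‖ = ε by linarith] at hsmul
  exact smul_right_injective E hρ.ne' hsmul

/-- A point of maximal distance to `o` in the image of the ball would be an interior point of the
image if it lay outside the ball, as `F` is open. -/
theorem image_closedBall_subset [ProperSpace E] {o : E} {r : ℝ} (F : E ≃ₜ E)
    (hF : F '' sphere o r = sphere o r) : F '' closedBall o r ⊆ closedBall o r := by
  rintro _ ⟨z, hz, rfl⟩
  obtain ⟨y, hy, hmax⟩ := (isCompact_closedBall o r).exists_isMaxOn ⟨z, hz⟩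
    (f := fun y => dist (F y) o) (by fun_prop)
  refine (hmax hz).trans (not_lt.1 fun (hlt : r < dist (F y) o) => ?_)
  have hyb : y ∈ ball o r := by
    refine lt_of_le_of_ne (mem_closedBall.1 hy) fun he => hlt.ne' ?_
    exact mem_sphere.1 (hF ▸ mem_image_of_mem F he)
  have hnhds : F '' ball o r ∈ 𝓝 (AffineMap.lineMap o (F y) (1 : ℝ)) := by
    rw [AffineMap.lineMap_apply_one]
    exact (F.isOpenMap _ isOpen_ball).mem_nhds (mem_image_of_mem F hyb)
  have hev : ∀ᶠ t : ℝ in 𝓝[>] 1, AffineMap.lineMap o (F y) t ∈ F '' ball o r :=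
    nhdsWithin_le_nhds (AffineMap.lineMap_continuous.continuousAt hnhds)
  obtain ⟨t, ⟨w, hw, hwt⟩, ht : 1 < t⟩ := (hev.and self_mem_nhdsWithin).exists
  have hle : dist (F w) o ≤ dist (F y) o := hmax (ball_subset_closedBall hw)
  rw [hwt, dist_lineMap_left, Real.norm_of_nonneg (by linarith), dist_comm o] at hle
  have hr : 0 < r := pos_of_mem_ball hw
  nlinarith

theorem image_ball_subset [ProperSpace E] {o : E} {r : ℝ} (F : E ≃ₜ E)
    (hF : F '' sphere o r = sphere o r) : F '' ball o r ⊆ ball o r := by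
  rw [← closedBall_sdiff_sphere, image_sdiff F.injective, hF]
  exact sdiff_subset_sdiff_left (image_closedBall_subset F hF)

theorem norm_add_sub_sub_fderiv_le {f : E → G} {L : ℝ≥0} (hf : Differentiable ℝ f)
    (hL : LipschitzWith L (fderiv ℝ f)) (x v : E) :
    ‖f (x + v) - f x - fderiv ℝ f x v‖ ≤ L / 2 * ‖v‖ ^ 2 := by
  have hderiv (t : ℝ) : HasDerivAt (fun t : ℝ => f (x + t • v) - f x - t • fderiv ℝ f x v)
      (fderiv ℝ f (x + t • v) v - fderiv ℝ f x v) t := by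
    have hline : HasDerivAt (fun t : ℝ => x + t • v) v t := by
      simpa using ((hasDerivAt_id t).smul_const v).const_add x
    have hlin : HasDerivAt (fun t : ℝ => t • fderiv ℝ f x v) (fderiv ℝ f x v) t := by
      simpa using (hasDerivAt_id t).smul_const (fderiv ℝ f x v)
    exact (((hf _).hasFDerivAt.comp_hasDerivAt t hline).sub_const (f x)).sub hlin
  have hbound (t : ℝ) :
      HasDerivAt (fun t : ℝ => L / 2 * ‖v‖ ^ 2 * t ^ 2) (L * ‖v‖ ^ 2 * t) t := by
    refine ((hasDerivAt_pow 2 t).const_mul (L / 2 * ‖v‖ ^ 2)).congr_deriv ?_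
    norm_num
    ring
  have hderiv_le (t : ℝ) (ht : t ∈ Ico (0 : ℝ) 1) :
      ‖fderiv ℝ f (x + t • v) v - fderiv ℝ f x v‖ ≤ L * ‖v‖ ^ 2 * t :=
    calc ‖fderiv ℝ f (x + t • v) v - fderiv ℝ f x v‖
        ≤ ‖fderiv ℝ f (x + t • v) - fderiv ℝ f x‖ * ‖v‖ :=
          (fderiv ℝ f (x + t • v) - fderiv ℝ f x).le_opNorm v
      _ ≤ L * ‖t • v‖ * ‖v‖ := by
          gcongr
          simpa [dist_eq_norm] using hL.dist_le_mul (x + t • v) x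
      _ = L * ‖v‖ ^ 2 * t := by rw [norm_smul_of_nonneg ht.1]; ring
  simpa using image_norm_le_of_norm_deriv_right_le_deriv_boundary (a := 0) (b := 1)
    (fun t _ => (hderiv t).continuousAt.continuousWithinAt)
    (fun t _ => (hderiv t).hasDerivWithinAt) (by simp) hbound hderiv_le
    (right_mem_Icc.2 zero_le_one)

end NormedSpace

section InnerProductSpace

variable {E : Type*} [NormedAddCommGroup E] [InnerProductSpace ℝ E]

theorem dist_sq_eq_dist_sq_add (c p s : E) :
    dist c s ^ 2 = dist c p ^ 2 + (‖s - p‖ ^ 2 - 2 * ⟪s - p, c - p⟫_ℝ) := by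
  rw [dist_eq_norm, dist_eq_norm, ← sub_sub_sub_cancel_right c s p, norm_sub_sq_real,
    real_inner_comm]
  ring

theorem dist_le_dist_iff_two_mul_inner_le {c p s : E} :
    dist c p ≤ dist c s ↔ 2 * ⟪s - p, c - p⟫_ℝ ≤ ‖s - p‖ ^ 2 := by
  rw [← sq_le_sq₀ dist_nonneg dist_nonneg, dist_sq_eq_dist_sq_add c p s, le_add_iff_nonneg_right,
    sub_nonneg]

theorem dist_lt_dist_iff_two_mul_inner_lt {c p s : E} :
    dist c p < dist c s ↔ 2 * ⟪s - p, c - p⟫_ℝ < ‖s - p‖ ^ 2 := by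
  rw [← sq_lt_sq₀ dist_nonneg dist_nonneg, dist_sq_eq_dist_sq_add c p s, lt_add_iff_pos_right,
    sub_pos]

theorem closedBall_inter_image_add_eq_singleton {K : Submodule ℝ E} {v : E} (hv : v ∈ Kᗮ) (p : E) :
    closedBall (p + v) ‖v‖ ∩ (fun w => p + w) '' (K : Set E) = {p} := by
  refine eq_singleton_iff_unique_mem.2 ⟨⟨?_, 0, K.zero_mem, add_zero p⟩, ?_⟩
  · rw [mem_closedBall, dist_self_add_right]
  · rintro _ ⟨hball, w, hw, rfl⟩
    rw [mem_closedBall', dist_add_left, dist_eq_norm] at hball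
    have hpyth := norm_sub_sq_eq_norm_sq_add_norm_sq_real
      (Submodule.inner_left_of_mem_orthogonal hw hv)
    have hw0 : ‖w‖ = 0 := by nlinarith [norm_nonneg (v - w), norm_nonneg w]
    simp only [norm_eq_zero.1 hw0, add_zero]

theorem eventually_mem_ball_of_hasDerivAt {γ : ℝ → E} {v c : E} (hγ : HasDerivAt γ v 0)
    (hv : 0 < ⟪v, c - γ 0⟫_ℝ) : ∀ᶠ t in 𝓝[>] 0, γ t ∈ ball c (dist c (γ 0)) := by
  have hderiv : HasDerivAt (fun t => ‖γ t - c‖ ^ 2) (2 * ⟪γ 0 - c, v⟫_ℝ) 0 :=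
    (hγ.sub_const c).norm_sq
  have hneg : 2 * ⟪γ 0 - c, v⟫_ℝ < 0 := by
    rw [← neg_sub c, inner_neg_left, real_inner_comm]
    linarith
  filter_upwards [hderiv.tendsto_slope_zero_right.eventually_lt_const hneg, self_mem_nhdsWithin]
    with t ht (ht0 : 0 < t)
  rw [zero_add, smul_eq_mul, inv_mul_lt_iff₀ ht0, mul_zero, sub_neg] at ht
  rw [mem_ball, dist_comm c, dist_eq_norm, dist_eq_norm]
  exact lt_of_pow_lt_pow_left₀ 2 (norm_nonneg _) ht

theorem sqrt_one_sub_sq_mul_le_inner {u v : E} {ε : ℝ} (hε : ε ≤ 1) (h : ‖u - v‖ ≤ ε * ‖v‖) :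
    √(1 - ε ^ 2) * ‖u‖ * ‖v‖ ≤ ⟪u, v⟫_ℝ := by
  rcases eq_or_ne v 0 with rfl | hv
  · simp
  have hε0 : 0 ≤ ε := nonneg_of_mul_nonneg_left ((norm_nonneg _).trans h) (norm_pos_iff.2 hv)
  have hsq : ‖u - v‖ ^ 2 ≤ (ε * ‖v‖) ^ 2 := by gcongr
  rw [norm_sub_sq_real] at hsq
  have hsqrt : √(1 - ε ^ 2) ^ 2 = 1 - ε ^ 2 := Real.sq_sqrt (by nlinarith)
  nlinarith [sq_nonneg (‖u‖ - √(1 - ε ^ 2) * ‖v‖)]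

/-- The left-hand side is convex in `b` and increasing for `b ≥ a`, so it is largest at
`b = M * a`. -/
theorem sq_add_sq_sub_two_mul_le {a b M k r : ℝ} (ha : 0 ≤ a) (hab : a ≤ b) (har : a ≤ r)
    (hM : 1 ≤ M) (hb : b ≤ M * a) (hk : k ≤ 1) :
    a ^ 2 + b ^ 2 - 2 * a * b * k ≤ r ^ 2 * (1 + M ^ 2 - 2 * M * k) := by
  have hX : 0 ≤ 1 + M ^ 2 - 2 * M * k := by nlinarith [sq_nonneg (1 - M)]
  have hmono : 0 ≤ (M * a - b) * (M * a + b - 2 * a * k) :=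
    mul_nonneg (by linarith) (by nlinarith)
  calc a ^ 2 + b ^ 2 - 2 * a * b * k ≤ a ^ 2 * (1 + M ^ 2 - 2 * M * k) := by nlinarith
    _ ≤ r ^ 2 * (1 + M ^ 2 - 2 * M * k) := by gcongr

theorem norm_smul_sub_smul_le {u u' : E} {ρ ρ' r M k : ℝ} (hu : ‖u‖ = 1) (hu' : ‖u'‖ = 1)
    (hρ : 0 ≤ ρ) (hρ' : 0 ≤ ρ') (hρr : ρ ≤ r) (hρr' : ρ' ≤ r) (hM : 1 ≤ M) (h : ρ ≤ M * ρ')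
    (h' : ρ' ≤ M * ρ) (hk : k ≤ ⟪u, u'⟫_ℝ) :
    ‖ρ • u - ρ' • u'‖ ≤ r * √(1 + M ^ 2 - 2 * M * k) := by
  have hk1 : k ≤ 1 := hk.trans (by simpa [hu, hu'] using real_inner_le_norm u u')
  have hr : 0 ≤ r := hρ.trans hρr
  have hX : 0 ≤ 1 + M ^ 2 - 2 * M * k := by nlinarith [sq_nonneg (1 - M)]
  refine le_of_sq_le_sq ?_ (by positivity)
  calc ‖ρ • u - ρ' • u'‖ ^ 2 = ρ ^ 2 + ρ' ^ 2 - 2 * (ρ * (ρ' * ⟪u, u'⟫_ℝ)) := by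
        rw [norm_sub_sq_real, real_inner_smul_left, real_inner_smul_right, norm_smul_of_nonneg hρ,
          norm_smul_of_nonneg hρ', hu, hu']
        ring
    _ ≤ ρ ^ 2 + ρ' ^ 2 - 2 * (ρ * (ρ' * k)) := by gcongr
    _ ≤ r ^ 2 * (1 + M ^ 2 - 2 * M * k) := by
        rcases le_total ρ ρ' with hle | hle
        · linarith [sq_add_sq_sub_two_mul_le hρ hle hρr hM h' hk1]
        · linarith [sq_add_sq_sub_two_mul_le hρ' hle hρr' hM h hk1]
    _ = (r * √(1 + M ^ 2 - 2 * M * k)) ^ 2 := by rw [mul_pow, Real.sq_sqrt hX]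

end InnerProductSpace

section ClosestPoints

variable {d : ℕ} {S : Set (EuclideanSpace ℝ (Fin d))} {p u c q x : EuclideanSpace ℝ (Fin d)}
  {ρ R t : ℝ}

theorem mem_closestPoints_iff : q ∈ closestPoints S x ↔ q ∈ S ∧ ∀ s ∈ S, dist x q ≤ dist x s := by
  refine and_congr_right fun hq => ⟨fun h s hs => h ▸ infDist_le_dist_of_mem hs, fun h => ?_⟩
  exact ((le_infDist ⟨q, hq⟩).2 fun s hs => h s hs).antisymm (infDist_le_dist_of_mem hq)

theorem mem_closestPoints_iff_two_mul_inner_le :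
    p ∈ closestPoints S c ↔ p ∈ S ∧ ∀ s ∈ S, 2 * ⟪s - p, c - p⟫_ℝ ≤ ‖s - p‖ ^ 2 := by
  simp only [mem_closestPoints_iff, dist_le_dist_iff_two_mul_inner_le]

theorem closestPoints_nonempty (hS : IsClosed S) (hne : S.Nonempty)
    (x : EuclideanSpace ℝ (Fin d)) : (closestPoints S x).Nonempty := by
  obtain ⟨q, hq, h⟩ := hS.exists_infDist_eq_dist hne x
  exact ⟨q, hq, h.symm⟩

theorem closestPoints_eq_singleton_of_notMem_medialAxis (hx : x ∉ medialAxis S)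
    (hq : q ∈ closestPoints S x) : closestPoints S x = {q} :=
  (not_nontrivial_iff.1 hx).eq_singleton_of_mem hq

theorem closestPoints_add_smul_eq_singleton (h : p ∈ closestPoints S (p + R • u)) (ht : 0 ≤ t)
    (htR : t < R) : closestPoints S (p + t • u) = {p} := by
  rw [mem_closestPoints_iff_two_mul_inner_le, add_sub_cancel_left] at h
  have hR : 0 < R := ht.trans_lt htR
  have hle (s) (hs : s ∈ S) :
      2 * ⟪s - p, p + t • u - p⟫_ℝ ≤ t / R * ‖s - p‖ ^ 2 :=
    calc 2 * ⟪s - p, p + t • u - p⟫_ℝ = t / R * (2 * ⟪s - p, R • u⟫_ℝ) := by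
          rw [add_sub_cancel_left, real_inner_smul_right, real_inner_smul_right]
          field_simp
      _ ≤ t / R * ‖s - p‖ ^ 2 := by gcongr; exact h.2 s hs
  have hp : p ∈ closestPoints S (p + t • u) := by
    refine mem_closestPoints_iff_two_mul_inner_le.2 ⟨h.1, fun s hs => (hle s hs).trans ?_⟩
    exact mul_le_of_le_one_left (by positivity) ((div_le_one hR).2 htR.le)
  refine eq_singleton_iff_unique_mem.2 ⟨hp, fun s hs => by_contra fun hsp => ?_⟩
  refine (dist_lt_dist_iff_two_mul_inner_lt.2 ((hle s hs.1).trans_lt ?_)).ne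
    (hp.2.trans hs.2.symm)
  have hpos : 0 < ‖s - p‖ := norm_pos_iff.2 (sub_ne_zero.2 hsp)
  exact mul_lt_of_lt_one_left (by positivity) ((div_lt_one hR).2 htR)

theorem coe_le_projectionRange_iff (hR : 0 < R) :
    (R : EReal) ≤ projectionRange S p u ↔ p ∈ closestPoints S (p + R • u) := by
  constructor
  · intro h
    have hmem : ∀ t ∈ Ioo 0 R, p ∈ closestPoints S (p + t • u) := fun t ht => by
      obtain ⟨_, ⟨t', ht', rfl⟩, htt'⟩ :=
        lt_sSup_iff.1 ((EReal.coe_lt_coe_iff.2 ht.2).trans_le h)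
      have hp : p ∈ closestPoints S (p + t' • u) := ht'.symm ▸ mem_singleton p
      exact closestPoints_add_smul_eq_singleton hp ht.1.le (EReal.coe_lt_coe_iff.1 htt') ▸
        mem_singleton p
    obtain ⟨t₀, ht₀⟩ := nonempty_Ioo.2 hR
    have hclosed : IsClosed {t : ℝ | dist (p + t • u) p = infDist (p + t • u) S} :=
      isClosed_eq (by fun_prop) ((continuous_infDist_pt S).comp (by fun_prop))
    refine ⟨(hmem t₀ ht₀).1, closure_minimal (fun t ht => (hmem t ht).2) hclosed ?_⟩
    rw [closure_Ioo hR.ne]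
    exact right_mem_Icc.2 hR.le
  · refine fun h => le_of_forall_lt fun b hb => ?_
    obtain ⟨t, hbt, htR⟩ := EReal.lt_iff_exists_real_btwn.1 (max_lt hb (EReal.coe_pos.2 hR))
    have ht : (0 : EReal) < t := (le_max_right _ _).trans_lt hbt
    exact ((le_max_left _ _).trans_lt hbt).trans_le (le_sSup ⟨t,
      closestPoints_add_smul_eq_singleton h (EReal.coe_pos.1 ht).le (EReal.coe_lt_coe_iff.1 htR),
      rfl⟩)

theorem projectionRange_le {B : ℝ} (hB : 0 ≤ B)
    (h : ∀ R, 0 < R → p ∈ closestPoints S (p + R • u) → R ≤ B) : projectionRange S p u ≤ B := by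
  by_contra! hlt
  obtain ⟨R, hBR, hR⟩ := EReal.lt_iff_exists_real_btwn.1 hlt
  have hBR' : B < R := EReal.coe_lt_coe_iff.1 hBR
  have hR0 : 0 < R := hB.trans_lt hBR'
  exact hBR'.not_ge (h R hR0 ((coe_le_projectionRange_iff hR0).1 hR.le))

theorem projectionRange_eq_of_add_smul_mem_medialAxis (hR : 0 < R)
    (hp : p ∈ closestPoints S (p + R • u)) (hc : p + R • u ∈ medialAxis S) :
    projectionRange S p u = R := by
  refine le_antisymm (projectionRange_le hR.le fun R' _ h => ?_)
    ((coe_le_projectionRange_iff hR).2 hp)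
  refine not_lt.1 fun hlt => not_nontrivial_singleton (x := p) ?_
  exact closestPoints_add_smul_eq_singleton h hR.le hlt ▸ hc

theorem sub_mem_generalizedNormal (h : p ∈ closestPoints S c) : c - p ∈ generalizedNormal S p := by
  rw [mem_closestPoints_iff_two_mul_inner_le] at h
  rintro v (rfl | hv)
  · rw [inner_zero_right]
  have hdir : ⟪c - p, ‖v‖⁻¹ • v⟫_ℝ ≤ 0 := by
    refine not_lt.1 fun hpos => ?_
    set a := ⟪c - p, ‖v‖⁻¹ • v⟫_ℝ
    have hK : 0 < 2⁻¹ + ‖c - p‖ := by positivity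
    obtain ⟨q, hq, hq0, hqε, hqv⟩ := hv (a / (2⁻¹ + ‖c - p‖)) (by positivity)
    have hsecant : ⟪c - p, ‖q - p‖⁻¹ • (q - p)⟫_ℝ ≤ 2⁻¹ * ‖q - p‖ := by
      rw [real_inner_smul_right, real_inner_comm, inv_mul_le_iff₀ hq0]
      linarith [h.2 q hq]
    have herror : ⟪c - p, ‖v‖⁻¹ • v - ‖q - p‖⁻¹ • (q - p)⟫_ℝ
        ≤ ‖c - p‖ * (a / (2⁻¹ + ‖c - p‖)) := by
      refine (real_inner_le_norm _ _).trans ?_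
      rw [norm_sub_rev (‖v‖⁻¹ • v)]
      gcongr
    rw [inner_sub_right] at herror
    linarith [mul_div_cancel₀ a hK.ne']
  rcases eq_or_ne v 0 with rfl | hv0
  · rw [inner_zero_right]
  rw [real_inner_smul_right] at hdir
  exact nonpos_of_mul_nonpos_right hdir (inv_pos.2 (norm_pos_iff.2 hv0))

theorem isMaximalEmptyBall_of_projectionRange_eq (hu : ‖u‖ = 1) (hρ : 0 < ρ)
    (h : projectionRange S p u = ρ) : IsMaximalEmptyBall S p u (p + ρ • u) ρ := by
  have hp := (coe_le_projectionRange_iff hρ).1 h.ge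
  refine ⟨⟨hp.1, hu, ?_, ?_⟩, ⟨hp.1, sub_mem_generalizedNormal hp, ?_⟩, rfl, h.symm⟩
  · exact h ▸ EReal.coe_pos.2 hρ
  · exact h ▸ EReal.coe_lt_top ρ
  · rw [add_sub_cancel_left, norm_smul_of_nonneg hρ.le, hu, mul_one]

theorem isMaximalEmptyBall_of_mem_medialAxis (hc : c ∈ medialAxis S)
    (hp : p ∈ closestPoints S c) :
    IsMaximalEmptyBall S p (NormedSpace.normalize (c - p)) c ‖c - p‖ := by
  have hcp : c - p ≠ 0 := by
    rw [sub_ne_zero]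
    rintro rfl
    refine not_nontrivial_singleton (x := c) (hc.mono fun q hq => ?_)
    exact (dist_eq_zero.1 (hq.2.trans (hp.2.symm.trans (dist_self c)))).symm
  have hcenter : p + ‖c - p‖ • NormedSpace.normalize (c - p) = c := by
    rw [NormedSpace.norm_smul_normalize, add_sub_cancel]
  have h := isMaximalEmptyBall_of_projectionRange_eq
    (NormedSpace.norm_normalize_eq_one_iff.2 hcp) (norm_pos_iff.2 hcp)
    (projectionRange_eq_of_add_smul_mem_medialAxis (S := S) (norm_pos_iff.2 hcp)
      (hcenter.symm ▸ hp) (hcenter.symm ▸ hc))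
  rwa [hcenter] at h

namespace IsMaximalEmptyBall

theorem norm_eq_one (h : IsMaximalEmptyBall S p u c ρ) : ‖u‖ = 1 :=
  h.mem_UBP.2.1

theorem radius_pos (h : IsMaximalEmptyBall S p u c ρ) : 0 < ρ :=
  EReal.coe_pos.1 (h.radius_eq ▸ h.mem_UBP.2.2.1)

theorem dist_center (h : IsMaximalEmptyBall S p u c ρ) : dist c p = ρ := by
  rw [h.center_eq, dist_add_smul_self h.norm_eq_one p h.radius_pos.le]

theorem add_smul_mem_closestPoints_iff (h : IsMaximalEmptyBall S p u c ρ) (hR : 0 < R) :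
    p ∈ closestPoints S (p + R • u) ↔ R ≤ ρ := by
  rw [← coe_le_projectionRange_iff hR, ← h.radius_eq, EReal.coe_le_coe_iff]

theorem mem_closestPoints (h : IsMaximalEmptyBall S p u c ρ) : p ∈ closestPoints S c := by
  rw [h.center_eq, h.add_smul_mem_closestPoints_iff h.radius_pos]

theorem axisProjection_eq (h : IsMaximalEmptyBall S p u c ρ) : axisProjection S p u = c := by
  rw [axisProjection, ← h.radius_eq, EReal.toReal_coe, ← h.center_eq]

end IsMaximalEmptyBall

end ClosestPoints

section ClosureOfMedialAxis

variable {d : ℕ} {S : Set (EuclideanSpace ℝ (Fin d))} {p u c q x : EuclideanSpace ℝ (Fin d)}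
  {ρ ε k : ℝ}

theorem eventually_closestPoints_subset (hS : IsClosed S) {U : Set (EuclideanSpace ℝ (Fin d))}
    (hU : IsOpen U) (h : closestPoints S x ⊆ U) : ∀ᶠ y in 𝓝 x, closestPoints S y ⊆ U := by
  rcases (S \ U).eq_empty_or_nonempty with hSU | hSU
  · exact Eventually.of_forall fun y z hz => sdiff_eq_empty.1 hSU hz.1
  have hlt : infDist x S < infDist x (S \ U) := by
    obtain ⟨z, hz, hxz⟩ := (hS.sdiff hU).exists_infDist_eq_dist hSU x
    rw [hxz]
    exact (infDist_le_dist_of_mem hz.1).lt_of_ne fun heq => hz.2 (h ⟨hz.1, heq.symm⟩)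
  filter_upwards [(continuous_infDist_pt S).continuousAt.eventually_lt
    (continuous_infDist_pt (S \ U)).continuousAt hlt] with y hy z hz
  by_contra hzU
  exact (hz.2.trans_lt hy).not_ge (infDist_le_dist_of_mem (show z ∈ S \ U from ⟨hz.1, hzU⟩))

theorem eventually_infDist_add_mul_lt (hS : IsClosed S) (hx : closestPoints S x = {q})
    (hxq : x ≠ q) (hk : k < 1) : ∀ᶠ t in 𝓝[>] (0 : ℝ),
      infDist x S + k * t < infDist (x + t • NormedSpace.normalize (x - q)) S := by
  set n := NormedSpace.normalize (x - q) with hn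
  have hxq0 : 0 < ‖x - q‖ := norm_pos_iff.2 (sub_ne_zero.2 hxq)
  have hq : q ∈ closestPoints S x := hx ▸ mem_singleton q
  have hsubset : closestPoints S x ⊆ {z | k * ‖x - z‖ < ⟪x - z, n⟫_ℝ} := by
    rw [hx, singleton_subset_iff, mem_ofPred_eq, hn, NormedSpace.normalize, real_inner_smul_right,
      real_inner_self_eq_norm_mul_norm, inv_mul_cancel_left₀ hxq0.ne']
    exact mul_lt_of_lt_one_left hxq0 hk
  have hnear : ∀ᶠ y in 𝓝 x, closestPoints S y ⊆ {z | k * ‖x - z‖ < ⟪x - z, n⟫_ℝ} :=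
    eventually_closestPoints_subset hS (isOpen_lt (by fun_prop) (by fun_prop)) hsubset
  have hline : Tendsto (fun t : ℝ => x + t • n) (𝓝[>] 0) (𝓝 x) := by
    have hcont : Continuous fun t : ℝ => x + t • n := by fun_prop
    simpa using (hcont.tendsto 0).mono_left nhdsWithin_le_nhds
  filter_upwards [hline.eventually hnear, self_mem_nhdsWithin] with t ht (ht0 : 0 < t)
  obtain ⟨z, hz⟩ := closestPoints_nonempty hS ⟨q, hq.1⟩ (x + t • n)
  have hinner : k * ‖x - z‖ < ⟪x - z, n⟫_ℝ := ht hz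
  have hxz : 0 < ‖x - z‖ := norm_pos_iff.2 fun h => by simp [h] at hinner
  have hproj : ‖x - z‖ * (‖x - z‖ + k * t) < ‖x - z‖ * dist (x + t • n) z :=
    calc ‖x - z‖ * (‖x - z‖ + k * t) = ‖x - z‖ ^ 2 + t * (k * ‖x - z‖) := by ring
      _ < ‖x - z‖ ^ 2 + t * ⟪x - z, n⟫_ℝ := by gcongr
      _ = ⟪x - z, x + t • n - z⟫_ℝ := by
          rw [add_sub_right_comm, inner_add_right, real_inner_self_eq_norm_sq,
            real_inner_smul_right]
      _ ≤ ‖x - z‖ * dist (x + t • n) z := by rw [dist_eq_norm]; exact real_inner_le_norm _ _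
  calc infDist x S + k * t ≤ ‖x - z‖ + k * t := by
        gcongr
        rw [← dist_eq_norm]
        exact infDist_le_dist_of_mem hz.1
    _ < dist (x + t • n) z := lt_of_mul_lt_mul_left hproj hxz.le
    _ = infDist (x + t • n) S := hz.2

/-- Maximise `z ↦ infDist z S - k * dist z x` over the ball: away from the medial axis a maximum
point cannot be interior, because the distance to `S` can be increased at any rate below `1`. -/
theorem exists_infDist_add_mul_le (hS : IsClosed S) (hne : S.Nonempty) (hε : 0 ≤ ε)
    (hεx : ε < infDist x S) (hdisj : Disjoint (closedBall x ε) (medialAxis S)) (hk0 : 0 ≤ k)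
    (hk : k < 1) : ∃ y ∈ closedBall x ε, infDist x S + k * ε ≤ infDist y S := by
  have hx : x ∈ closedBall x ε := mem_closedBall_self hε
  have hcont : Continuous fun z => infDist z S - k * dist z x :=
    (continuous_infDist_pt S).sub (by fun_prop)
  obtain ⟨z, hz, hmax⟩ := (isCompact_closedBall x ε).exists_isMaxOn ⟨x, hx⟩ hcont.continuousOn
  have hzε : dist z x = ε := by
    refine le_antisymm hz (not_lt.1 fun hzlt => ?_)
    obtain ⟨q, hq⟩ := closestPoints_nonempty hS hne z
    have hzq : z ≠ q := by
      rw [← dist_pos, hq.2]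
      linarith [infDist_le_infDist_add_dist (s := S) (x := x) (y := z), dist_comm x z]
    have hn : ‖NormedSpace.normalize (z - q)‖ = 1 :=
      NormedSpace.norm_normalize_eq_one_iff.2 (sub_ne_zero.2 hzq)
    obtain ⟨t, hgrowth, ht0, htε⟩ := ((eventually_infDist_add_mul_lt hS
      (closestPoints_eq_singleton_of_notMem_medialAxis (disjoint_left.1 hdisj hz) hq) hzq hk).and
      (Ioo_mem_nhdsGT (sub_pos.2 hzlt))).exists
    set z' := z + t • NormedSpace.normalize (z - q)
    have hz'x : dist z' x ≤ t + dist z x :=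
      (dist_triangle z' z x).trans_eq (by rw [dist_add_smul_self hn z ht0.le])
    have hle : infDist z' S - k * dist z' x ≤ infDist z S - k * dist z x :=
      hmax (mem_closedBall.2 (by linarith))
    have hpenalty : k * dist z' x ≤ k * (t + dist z x) := by gcongr
    linarith
  have hle : infDist x S - k * dist x x ≤ infDist z S - k * dist z x := hmax hx
  rw [dist_self, hzε] at hle
  exact ⟨z, hz, by linarith⟩

theorem exists_infDist_add_le (hS : IsClosed S) (hne : S.Nonempty) (hε : 0 ≤ ε)
    (hεx : ε < infDist x S) (hdisj : Disjoint (closedBall x ε) (medialAxis S)) :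
    ∃ y ∈ closedBall x ε, infDist x S + ε ≤ infDist y S := by
  obtain ⟨y, hy, hmax⟩ := (isCompact_closedBall x ε).exists_isMaxOn
    ⟨x, mem_closedBall_self hε⟩ (continuous_infDist_pt S).continuousOn
  have hle : ∀ k ∈ Ioo (0 : ℝ) 1, infDist x S + k * ε ≤ infDist y S := fun k hk => by
    obtain ⟨z, hz, hxz⟩ := exists_infDist_add_mul_le hS hne hε hεx hdisj hk.1.le hk.2
    exact hxz.trans (hmax hz)
  have hlim : Tendsto (fun k : ℝ => infDist x S + k * ε) (𝓝[<] 1) (𝓝 (infDist x S + 1 * ε)) :=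
    ((by fun_prop : Continuous fun k : ℝ => infDist x S + k * ε).tendsto 1).mono_left
      nhdsWithin_le_nhds
  rw [one_mul] at hlim
  exact ⟨y, hy, le_of_tendsto hlim (mem_of_superset (Ioo_mem_nhdsLT zero_lt_one) hle)⟩

/-- If the centre had a neighbourhood free of the medial axis, the distance to `S` would grow from
the centre at unit rate. This is only possible in the direction `u`, so a larger ball would still
be empty. -/
theorem IsMaximalEmptyBall.center_mem_closure_medialAxis (h : IsMaximalEmptyBall S p u c ρ)
    (hS : IsClosed S) : c ∈ closure (medialAxis S) := by
  by_contra hc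
  have hp := h.mem_closestPoints
  have hρ := h.radius_pos
  obtain ⟨ε₀, hε₀, hball⟩ := Metric.isOpen_iff.1 isClosed_closure.isOpen_compl c hc
  obtain ⟨ε, hε, hεmin⟩ := exists_between (lt_min hε₀ hρ)
  have hcS : infDist c S = ρ := hp.2.symm.trans h.dist_center
  have hdisj : Disjoint (closedBall c ε) (medialAxis S) := disjoint_left.2 fun z hz hzS =>
    hball (closedBall_subset_ball (hεmin.trans_le (min_le_left _ _)) hz) (subset_closure hzS)
  obtain ⟨y, hyc, hy⟩ := exists_infDist_add_le hS ⟨p, hp.1⟩ hε.le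
    (hcS.symm ▸ hεmin.trans_le (min_le_right _ _)) hdisj
  rw [hcS] at hy
  have hyp : infDist y S ≤ dist y p := infDist_le_dist_of_mem hp.1
  have hyu : y - c = ε • u := by
    refine eq_smul_of_add_le_norm_smul_add h.norm_eq_one hρ (mem_closedBall_iff_norm.1 hyc) ?_
    rw [← sub_eq_iff_eq_add'.2 h.center_eq, sub_add_sub_cancel', ← dist_eq_norm]
    exact hy.trans hyp
  have hyeq : y = p + (ρ + ε) • u := by
    rw [add_smul, ← add_assoc, ← h.center_eq, ← hyu, add_sub_cancel]
  have hpy : p ∈ closestPoints S y := by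
    refine ⟨hp.1, hyp.antisymm' ?_⟩
    rwa [hyeq, dist_add_smul_self h.norm_eq_one p (by positivity), ← hyeq]
  rw [hyeq] at hpy
  linarith [(h.add_smul_mem_closestPoints_iff (by positivity)).1 hpy]

end ClosureOfMedialAxis

section BoundingSphere

variable {d : ℕ} {S : Set (EuclideanSpace ℝ (Fin d))} {p u c o : EuclideanSpace ℝ (Fin d)}
  {ρ r R t : ℝ}

/-- A closest point of a point `c` outside the ball can only be the radial projection of `c`. -/
theorem medialAxis_subset_ball (hSball : S ⊆ closedBall o r) (hsphere : sphere o r ⊆ S) :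
    medialAxis S ⊆ ball o r := by
  intro c hc
  have hclosest : closestPoints S c ⊆ closedBall o r := fun a ha => hSball ha.1
  rcases le_or_gt r 0 with hr | hr
  · exact absurd ((subsingleton_closedBall o hr).anti hclosest) hc.not_subsingleton
  by_contra! hcr
  rw [mem_ball', not_lt] at hcr
  have hoc : 0 < dist o c := hr.trans_le hcr
  set q := AffineMap.lineMap o c (r / dist o c)
  have hqS : q ∈ S := hsphere <| by
    rw [mem_sphere, dist_lineMap_left, Real.norm_of_nonneg (by positivity),
      div_mul_cancel₀ _ hoc.ne']
  have hqc : dist c q = dist o c - r := by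
    rw [dist_comm, dist_lineMap_right, Real.norm_of_nonneg (sub_nonneg.2 ((div_le_one hoc).2 hcr)),
      sub_mul, one_mul, div_mul_cancel₀ _ hoc.ne']
  refine hc.not_subsingleton (subsingleton_of_forall_eq q fun a ha => ?_)
  have hoa : dist o a ≤ r := mem_closedBall'.1 (hclosest ha)
  have hac : dist a c ≤ dist o c - r := by
    rw [dist_comm, ← hqc]
    exact (mem_closestPoints_iff.1 ha).2 q hqS
  have htriangle := dist_triangle o a c
  refine eq_lineMap_of_dist_eq_mul_of_dist_eq_mul ?_ ?_
  · rw [div_mul_cancel₀ _ hoc.ne']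
    linarith
  · rw [sub_mul, one_mul, div_mul_cancel₀ _ hoc.ne']
    linarith

theorem ball_subset_ball_of_mem_closestPoints (hsphere : sphere o r ⊆ S)
    (hp : p ∈ closestPoints S c) (hne : (ball c (dist c p) ∩ ball o r).Nonempty) :
    ball c (dist c p) ⊆ ball o r :=
  subset_ball_of_disjoint_sphere (convex_ball c _).isPreconnected
    (disjoint_left.2 fun z hz hzo =>
      ((mem_closestPoints_iff.1 hp).2 z (hsphere hzo)).not_gt (mem_ball'.1 hz)) hne

theorem le_radius_of_mem_closestPoints (hsphere : sphere o r ⊆ S) (hu : ‖u‖ = 1) (ht : 0 < t)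
    (htR : t < 2 * R) (hpt : p + t • u ∈ ball o r) (hp : p ∈ closestPoints S (p + R • u)) :
    R ≤ r := by
  have hR : 0 < R := by linarith
  have := nontrivial_of_norm_eq_one hu
  have hdist : dist (p + R • u) p = R := dist_add_smul_self hu p hR.le
  have hmem : p + t • u ∈ ball (p + R • u) (dist (p + R • u) p) := by
    rw [mem_ball, hdist, dist_add_left, dist_eq_norm, ← sub_smul, norm_smul, hu, mul_one,
      Real.norm_eq_abs, abs_lt]
    constructor <;> linarith
  have hsub := ball_subset_ball_of_mem_closestPoints hsphere hp ⟨_, hmem, hpt⟩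
  rw [hdist] at hsub
  exact radius_le_of_ball_subset_ball hR hsub

namespace IsMaximalEmptyBall

theorem ball_subset (h : IsMaximalEmptyBall S p u c ρ) (hsphere : sphere o r ⊆ S)
    (hc : c ∈ ball o r) : ball c ρ ⊆ ball o r := by
  have hsub := ball_subset_ball_of_mem_closestPoints hsphere h.mem_closestPoints
    ⟨c, mem_ball_self (h.dist_center.symm ▸ h.radius_pos), hc⟩
  rwa [h.dist_center] at hsub

theorem radius_le (h : IsMaximalEmptyBall S p u c ρ) (hsphere : sphere o r ⊆ S)
    (hc : c ∈ ball o r) : ρ ≤ r :=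
  le_radius_of_mem_closestPoints hsphere h.norm_eq_one h.radius_pos
    (lt_two_mul_self h.radius_pos) (h.center_eq ▸ hc) (h.center_eq ▸ h.mem_closestPoints)

end IsMaximalEmptyBall

end BoundingSphere

section Diffeomorphism

variable {d : ℕ} {S : Set (EuclideanSpace ℝ (Fin d))} {p u c : EuclideanSpace ℝ (Fin d)} {ρ : ℝ}
  {F : EuclideanSpace ℝ (Fin d) ≃ EuclideanSpace ℝ (Fin d)} {LF LDF : ℝ≥0}

/-- The vector `(D_pF^t)⁻¹ u`. Normalizing it gives `imageNormal F p u`, but unlike the latter it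
depends linearly on `u`. -/
noncomputable def conormal (F : EuclideanSpace ℝ (Fin d) → EuclideanSpace ℝ (Fin d))
    (p u : EuclideanSpace ℝ (Fin d)) : EuclideanSpace ℝ (Fin d) :=
  (ContinuousLinearMap.adjoint (fderiv ℝ F p)).inverse u

theorem normalize_conormal (F : EuclideanSpace ℝ (Fin d) → EuclideanSpace ℝ (Fin d))
    (p u : EuclideanSpace ℝ (Fin d)) :
    NormedSpace.normalize (conormal F p u) = imageNormal F p u :=
  rfl

theorem norm_conormal_smul_imageNormal (F : EuclideanSpace ℝ (Fin d) → EuclideanSpace ℝ (Fin d))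
    (p u : EuclideanSpace ℝ (Fin d)) : ‖conormal F p u‖ • imageNormal F p u = conormal F p u :=
  NormedSpace.norm_smul_normalize _

namespace IsC11Diffeo

theorem symm (hF : IsC11Diffeo F LF LDF) : IsC11Diffeo F.symm LF LDF :=
  ⟨hF.contDiff_symm, hF.contDiff, hF.lipschitz_symm, hF.lipschitz, hF.lipschitz_fderiv_symm,
    hF.lipschitz_fderiv⟩

theorem differentiable (hF : IsC11Diffeo F LF LDF) : Differentiable ℝ F :=
  hF.contDiff.differentiable one_ne_zero

/-- The homeomorphism underlying a `C^{1,1}` diffeomorphism. -/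
def toHomeomorph (hF : IsC11Diffeo F LF LDF) :
    EuclideanSpace ℝ (Fin d) ≃ₜ EuclideanSpace ℝ (Fin d) where
  toEquiv := F
  continuous_toFun := hF.contDiff.continuous
  continuous_invFun := hF.contDiff_symm.continuous

theorem fderiv_symm_comp (hF : IsC11Diffeo F LF LDF) (p : EuclideanSpace ℝ (Fin d)) :
    (fderiv ℝ F.symm (F p)) ∘L (fderiv ℝ F p) = .id ℝ _ := by
  rw [← fderiv_comp p (hF.symm.differentiable _) (hF.differentiable p), F.symm_comp_self,
    fderiv_id]

theorem fderiv_comp_symm (hF : IsC11Diffeo F LF LDF) (p : EuclideanSpace ℝ (Fin d)) :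
    (fderiv ℝ F p) ∘L (fderiv ℝ F.symm (F p)) = .id ℝ _ := by
  simpa only [Equiv.symm_symm, Equiv.symm_apply_apply] using hF.symm.fderiv_symm_comp (F p)

theorem fderiv_symm_apply (hF : IsC11Diffeo F LF LDF) (p v : EuclideanSpace ℝ (Fin d)) :
    fderiv ℝ F.symm (F p) (fderiv ℝ F p v) = v :=
  DFunLike.congr_fun (hF.fderiv_symm_comp p) v

theorem fderiv_apply_symm (hF : IsC11Diffeo F LF LDF) (p v : EuclideanSpace ℝ (Fin d)) :
    fderiv ℝ F p (fderiv ℝ F.symm (F p) v) = v :=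
  DFunLike.congr_fun (hF.fderiv_comp_symm p) v

theorem norm_fderiv_le (hF : IsC11Diffeo F LF LDF) (p : EuclideanSpace ℝ (Fin d)) :
    ‖fderiv ℝ F p‖ ≤ LF :=
  norm_fderiv_le_of_lipschitz ℝ hF.lipschitz

theorem one_le [Nontrivial (EuclideanSpace ℝ (Fin d))] (hF : IsC11Diffeo F LF LDF) :
    (1 : ℝ) ≤ LF := by
  have hid : ‖ContinuousLinearMap.id ℝ (EuclideanSpace ℝ (Fin d))‖ ≤ LF * LF := by
    rw [← hF.fderiv_symm_comp 0]
    refine (ContinuousLinearMap.opNorm_comp_le _ _).trans ?_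
    gcongr
    exacts [hF.symm.norm_fderiv_le _, hF.norm_fderiv_le 0]
  rw [ContinuousLinearMap.norm_id] at hid
  nlinarith [LF.coe_nonneg]

theorem conormal_eq (hF : IsC11Diffeo F LF LDF) (p u : EuclideanSpace ℝ (Fin d)) :
    conormal F p u = ContinuousLinearMap.adjoint (fderiv ℝ F.symm (F p)) u := by
  rw [conormal, ContinuousLinearMap.inverse_eq
    (g := ContinuousLinearMap.adjoint (fderiv ℝ F.symm (F p)))]
  · rw [← ContinuousLinearMap.adjoint_comp, hF.fderiv_symm_comp, ContinuousLinearMap.adjoint_id]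
  · rw [← ContinuousLinearMap.adjoint_comp, hF.fderiv_comp_symm, ContinuousLinearMap.adjoint_id]

theorem inner_conormal (hF : IsC11Diffeo F LF LDF) (p u w : EuclideanSpace ℝ (Fin d)) :
    ⟪w, conormal F p u⟫_ℝ = ⟪fderiv ℝ F.symm (F p) w, u⟫_ℝ := by
  rw [hF.conormal_eq, ContinuousLinearMap.adjoint_inner_right]

theorem adjoint_conormal (hF : IsC11Diffeo F LF LDF) (p u : EuclideanSpace ℝ (Fin d)) :
    ContinuousLinearMap.adjoint (fderiv ℝ F p) (conormal F p u) = u := by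
  refine ext_inner_left ℝ fun w => ?_
  rw [ContinuousLinearMap.adjoint_inner_right, hF.inner_conormal, hF.fderiv_symm_apply]

theorem norm_le_mul_norm_conormal (hF : IsC11Diffeo F LF LDF) (p u : EuclideanSpace ℝ (Fin d)) :
    ‖u‖ ≤ LF * ‖conormal F p u‖ :=
  calc ‖u‖ = ‖ContinuousLinearMap.adjoint (fderiv ℝ F p) (conormal F p u)‖ := by
        rw [hF.adjoint_conormal]
    _ ≤ ‖ContinuousLinearMap.adjoint (fderiv ℝ F p)‖ * ‖conormal F p u‖ :=
        ContinuousLinearMap.le_opNorm _ _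
    _ ≤ LF * ‖conormal F p u‖ := by
        rw [LinearIsometryEquiv.norm_map]
        gcongr
        exact hF.norm_fderiv_le p

theorem conormal_ne_zero (hF : IsC11Diffeo F LF LDF) (p : EuclideanSpace ℝ (Fin d)) (hu : u ≠ 0) :
    conormal F p u ≠ 0 := fun h => hu <| by
  rw [← hF.adjoint_conormal p u, h, map_zero]

theorem norm_imageNormal (hF : IsC11Diffeo F LF LDF) (p : EuclideanSpace ℝ (Fin d))
    (hu : u ≠ 0) : ‖imageNormal F p u‖ = 1 :=
  NormedSpace.norm_normalize_eq_one_iff.2 (hF.conormal_ne_zero p hu)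

theorem imageNormal_symm (hF : IsC11Diffeo F LF LDF) (p : EuclideanSpace ℝ (Fin d))
    (hu : ‖u‖ = 1) : imageNormal F.symm (F p) (imageNormal F p u) = u := by
  have hu0 : u ≠ 0 := ne_zero_of_norm_eq_one hu
  have hpos : 0 < ‖conormal F p u‖⁻¹ := inv_pos.2 (norm_pos_iff.2 (hF.conormal_ne_zero p hu0))
  have hconormal : conormal F.symm (F p) (imageNormal F p u) = ‖conormal F p u‖⁻¹ • u := by
    rw [hF.symm.conormal_eq, Equiv.symm_symm, Equiv.symm_apply_apply, ← normalize_conormal,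
      NormedSpace.normalize, map_smul, hF.adjoint_conormal]
  rw [← normalize_conormal, hconormal, NormedSpace.normalize_smul_of_pos hpos,
    NormedSpace.normalize_eq_self_of_norm_eq_one hu]

theorem map_orthogonal (hF : IsC11Diffeo F LF LDF) (p : EuclideanSpace ℝ (Fin d)) (hu : u ≠ 0) :
    Submodule.map (fderiv ℝ F p).toLinearMap (ℝ ∙ u)ᗮ = (ℝ ∙ imageNormal F p u)ᗮ := by
  have hnorm : ‖conormal F p u‖⁻¹ ≠ 0 :=
    inv_ne_zero (norm_ne_zero_iff.2 (hF.conormal_ne_zero p hu))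
  ext w
  have hw : w ∈ (ℝ ∙ imageNormal F p u)ᗮ ↔ ⟪fderiv ℝ F.symm (F p) w, u⟫_ℝ = 0 := by
    rw [Submodule.mem_orthogonal_singleton_iff_inner_left, ← normalize_conormal,
      NormedSpace.normalize, real_inner_smul_right, mul_eq_zero_iff_left hnorm, hF.inner_conormal]
  rw [hw, Submodule.mem_map]
  simp only [Submodule.mem_orthogonal_singleton_iff_inner_left, ContinuousLinearMap.coe_coe]
  constructor
  · rintro ⟨v, hv, rfl⟩
    rwa [hF.fderiv_symm_apply]
  · exact fun h => ⟨_, h, hF.fderiv_apply_symm p w⟩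

theorem eventually_mem_image_ball (hF : IsC11Diffeo F LF LDF) (p : EuclideanSpace ℝ (Fin d))
    (hu : ‖u‖ = 1) (hρ : 0 < ρ) :
    ∀ᶠ t : ℝ in 𝓝[>] 0, F p + t • imageNormal F p u ∈ F '' ball (p + ρ • u) ρ := by
  have hu0 : u ≠ 0 := ne_zero_of_norm_eq_one hu
  have hγ0 : F.symm (F p + (0 : ℝ) • imageNormal F p u) = p := by
    rw [zero_smul, add_zero, F.symm_apply_apply]
  have hγ : HasDerivAt (fun t : ℝ => F.symm (F p + t • imageNormal F p u))
      (fderiv ℝ F.symm (F p) (imageNormal F p u)) 0 :=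
    (hF.symm.differentiable (F p)).hasFDerivAt.hasLineDerivAt _
  have hinner : 0 < ⟪fderiv ℝ F.symm (F p) (imageNormal F p u), p + ρ • u - p⟫_ℝ := by
    rw [add_sub_cancel_left, real_inner_smul_right, ← hF.inner_conormal,
      ← norm_conormal_smul_imageNormal, real_inner_smul_right, real_inner_self_eq_norm_sq,
      hF.norm_imageNormal p hu0]
    have := norm_pos_iff.2 (hF.conormal_ne_zero p hu0)
    positivity
  filter_upwards [eventually_mem_ball_of_hasDerivAt (c := p + ρ • u) hγ
    (by rwa [hγ0])] with t ht
  rw [hγ0, dist_add_smul_self hu p hρ.le] at ht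
  exact ⟨_, ht, F.apply_symm_apply _⟩

/-- To second order `F.symm (F p + w) - p` is `fderiv ℝ F.symm (F p) w`, whose inner product with
`u` is the inner product of `w` with the conormal. -/
theorem mem_closestPoints_image (hF : IsC11Diffeo F LF LDF) (hu : ‖u‖ = 1) (hρ : 0 < ρ)
    (h : p ∈ closestPoints S (p + ρ • u)) :
    F p ∈ closestPoints (F '' S) (F p + (ρ / (LF ^ 2 + ρ * LDF)) • conormal F p u) := by
  have := nontrivial_of_norm_eq_one hu
  have hLF := hF.one_le
  have hK : 0 < (LF : ℝ) ^ 2 + ρ * LDF := by positivity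
  rw [mem_closestPoints_iff_two_mul_inner_le, add_sub_cancel_left] at h ⊢
  refine ⟨mem_image_of_mem F h.1, ?_⟩
  rintro _ ⟨s, hs, rfl⟩
  obtain ⟨w, hw⟩ : ∃ w, w = F s - F p := ⟨_, rfl⟩
  have hsw : F.symm (F p + w) = s := by rw [hw, add_sub_cancel, F.symm_apply_apply]
  have hclosest : 2 * (ρ * ⟪s - p, u⟫_ℝ) ≤ ‖s - p‖ ^ 2 := by
    rw [← real_inner_smul_right]
    exact h.2 s hs
  have hlipschitz : ‖s - p‖ ≤ LF * ‖w‖ := by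
    rw [hw]
    simpa only [dist_eq_norm, F.symm_apply_apply] using hF.lipschitz_symm.dist_le_mul (F s) (F p)
  have htaylor : ⟪w, conormal F p u⟫_ℝ - ⟪s - p, u⟫_ℝ ≤ LDF / 2 * ‖w‖ ^ 2 :=
    calc ⟪w, conormal F p u⟫_ℝ - ⟪s - p, u⟫_ℝ
        = -⟪s - p - fderiv ℝ F.symm (F p) w, u⟫_ℝ := by
          rw [hF.inner_conormal, inner_sub_left (s - p), neg_sub]
      _ ≤ ‖s - p - fderiv ℝ F.symm (F p) w‖ * ‖u‖ :=
          (neg_le_abs _).trans (abs_real_inner_le_norm _ _)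
      _ ≤ LDF / 2 * ‖w‖ ^ 2 := by
          rw [hu, mul_one]
          simpa only [F.symm_apply_apply, hsw] using norm_add_sub_sub_fderiv_le
            hF.symm.differentiable hF.lipschitz_fderiv_symm (F p) w
  rw [← hw, real_inner_smul_right, div_mul_eq_mul_div, mul_div_assoc', div_le_iff₀ hK]
  have hsq : ‖s - p‖ ^ 2 ≤ (LF * ‖w‖) ^ 2 := by gcongr
  linarith [mul_le_mul_of_nonneg_left htaylor hρ.le]

theorem sqrt_one_sub_sq_le_inner_imageNormal (hF : IsC11Diffeo F LF LDF) (hu : ‖u‖ = 1) {ε : ℝ}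
    (hε1 : ε ≤ 1)
    (hε : ‖fderiv ℝ F p - ContinuousLinearMap.id ℝ (EuclideanSpace ℝ (Fin d))‖ ≤ ε) :
    √(1 - ε ^ 2) ≤ ⟪u, imageNormal F p u⟫_ℝ := by
  have hpos : 0 < ‖conormal F p u‖ :=
    norm_pos_iff.2 (hF.conormal_ne_zero p (ne_zero_of_norm_eq_one hu))
  have hsub : ‖u - conormal F p u‖ ≤ ε * ‖conormal F p u‖ :=
    calc ‖u - conormal F p u‖
        = ‖ContinuousLinearMap.adjoint (fderiv ℝ F p - ContinuousLinearMap.id ℝ _)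
            (conormal F p u)‖ := by
          rw [map_sub, ContinuousLinearMap.adjoint_id, sub_apply, hF.adjoint_conormal,
            ContinuousLinearMap.id_apply]
      _ ≤ ‖ContinuousLinearMap.adjoint (fderiv ℝ F p - ContinuousLinearMap.id ℝ _)‖ *
            ‖conormal F p u‖ := ContinuousLinearMap.le_opNorm _ _
      _ ≤ ε * ‖conormal F p u‖ := by
          rw [LinearIsometryEquiv.norm_map]
          gcongr
  have hinner := sqrt_one_sub_sq_mul_le_inner hε1 hsub
  rw [hu, mul_one, ← norm_conormal_smul_imageNormal, real_inner_smul_right,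
    norm_conormal_smul_imageNormal, mul_comm] at hinner
  exact le_of_mul_le_mul_left hinner hpos

end IsC11Diffeo

end Diffeomorphism

section Image

variable {d : ℕ} {S : Set (EuclideanSpace ℝ (Fin d))}
  {p u c c' o : EuclideanSpace ℝ (Fin d)} {ρ ρ' r ε₁ ε₂ : ℝ}
  {F : EuclideanSpace ℝ (Fin d) ≃ EuclideanSpace ℝ (Fin d)} {LF LDF : ℝ≥0}

theorem le_mul_of_div_cube_add_le {a b r L D : ℝ} (ha : 0 ≤ a) (har : a ≤ r) (hb : 0 ≤ b)
    (hL : 1 ≤ L) (hD : 0 ≤ D) (h : a / (L ^ 3 + a * D * L ^ 2) ≤ b) :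
    a ≤ L ^ 3 * (1 + 4 * r * D * L ^ 2) * b := by
  rw [div_le_iff₀' (by positivity)] at h
  refine h.trans (mul_le_mul_of_nonneg_right ?_ hb)
  have hr : 0 ≤ r := ha.trans har
  have hDL : 0 ≤ 4 * r * (D * L ^ 2) := by positivity
  calc L ^ 3 + a * D * L ^ 2 = L ^ 3 + a * (D * L ^ 2) := by ring
    _ ≤ L ^ 3 + 4 * r * (D * L ^ 2) := by
        gcongr
        linarith
    _ ≤ L ^ 3 + L ^ 3 * (4 * r * (D * L ^ 2)) := by
        linarith [le_mul_of_one_le_left hDL (one_le_pow₀ hL (n := 3))]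
    _ = L ^ 3 * (1 + 4 * r * D * L ^ 2) := by ring

namespace IsC11Diffeo

theorem coe_le_projectionRange_image (hF : IsC11Diffeo F LF LDF) (hu : ‖u‖ = 1) (hρ : 0 < ρ)
    (h : p ∈ closestPoints S (p + ρ • u)) :
    ((ρ / (LF ^ 3 + ρ * LDF * LF ^ 2) : ℝ) : EReal) ≤
      projectionRange (F '' S) (F p) (imageNormal F p u) := by
  have := nontrivial_of_norm_eq_one hu
  have hLF := hF.one_le
  have hnorm : 1 ≤ LF * ‖conormal F p u‖ := hu ▸ hF.norm_le_mul_norm_conormal p u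
  have hpos : 0 < ‖conormal F p u‖ := pos_of_mul_pos_right (one_pos.trans_le hnorm) LF.coe_nonneg
  refine le_trans (EReal.coe_le_coe_iff.2 ?_) <|
    (coe_le_projectionRange_iff (R := ρ / (LF ^ 2 + ρ * LDF) * ‖conormal F p u‖)
      (by positivity)).2 ?_
  · calc ρ / (LF ^ 3 + ρ * LDF * LF ^ 2)
        ≤ ρ / (LF * (LF ^ 2 + ρ * LDF)) := by
          gcongr
          nlinarith [mul_nonneg (mul_nonneg hρ.le LDF.coe_nonneg)
            (mul_nonneg LF.coe_nonneg (sub_nonneg.2 hLF))]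
      _ = ρ / (LF ^ 2 + ρ * LDF) * (1 / LF) := by field_simp
      _ ≤ ρ / (LF ^ 2 + ρ * LDF) * ‖conormal F p u‖ := by
          gcongr
          rwa [div_le_iff₀' (one_pos.trans_le hLF)]
  · rw [mul_smul, norm_conormal_smul_imageNormal]
    exact hF.mem_closestPoints_image hu hρ h

theorem image_ball_subset (hF : IsC11Diffeo F LF LDF) (hFsphere : F '' sphere o r = sphere o r) :
    F '' ball o r ⊆ ball o r :=
  _root_.image_ball_subset hF.toHomeomorph hFsphere

theorem image_closedBall_subset (hF : IsC11Diffeo F LF LDF)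
    (hFsphere : F '' sphere o r = sphere o r) : F '' closedBall o r ⊆ closedBall o r :=
  _root_.image_closedBall_subset hF.toHomeomorph hFsphere

theorem isClosed_image (hF : IsC11Diffeo F LF LDF) (hS : IsClosed S) : IsClosed (F '' S) :=
  hF.toHomeomorph.isClosed_image.2 hS

end IsC11Diffeo

namespace IsMaximalEmptyBall

theorem exists_image (h : IsMaximalEmptyBall S p u c ρ) (hF : IsC11Diffeo F LF LDF)
    (hFsphere : F '' sphere o r = sphere o r) (hsphere : sphere o r ⊆ S) (hc : c ∈ ball o r) :
    ∃ c' ρ', IsMaximalEmptyBall (F '' S) (F p) (imageNormal F p u) c' ρ' ∧ ρ' ≤ r := by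
  have := nontrivial_of_norm_eq_one h.norm_eq_one
  have hLF := hF.one_le
  have hρ := h.radius_pos
  have hu' := hF.norm_imageNormal p (ne_zero_of_norm_eq_one h.norm_eq_one)
  have hsphere' : sphere o r ⊆ F '' S := hFsphere ▸ image_mono hsphere
  have hinside := hF.eventually_mem_image_ball p h.norm_eq_one hρ
  rw [← h.center_eq] at hinside
  have hle : projectionRange (F '' S) (F p) (imageNormal F p u) ≤ r := by
    refine projectionRange_le (dist_nonneg.trans (mem_ball.1 hc).le) fun R hR hpR => ?_
    obtain ⟨t, ht, ht0, htR⟩ :=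
      (hinside.and (Ioo_mem_nhdsGT (show 0 < 2 * R by positivity))).exists
    exact le_radius_of_mem_closestPoints hsphere' hu' ht0 htR
      (hF.image_ball_subset hFsphere (image_mono (h.ball_subset hsphere hc) ht)) hpR
  have hpos : 0 < projectionRange (F '' S) (F p) (imageNormal F p u) :=
    (EReal.coe_pos.2 (by positivity)).trans_le
      (hF.coe_le_projectionRange_image h.norm_eq_one hρ (h.center_eq ▸ h.mem_closestPoints))
  have hcoe := EReal.coe_toReal (hle.trans_lt (EReal.coe_lt_top r)).ne
    ((EReal.bot_lt_zero.trans hpos).ne')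
  refine ⟨_, _, isMaximalEmptyBall_of_projectionRange_eq hu' ?_ hcoe.symm, ?_⟩
  · rwa [← EReal.coe_pos, hcoe]
  · rwa [← EReal.coe_le_coe_iff, hcoe]

theorem div_le_radius_image (h : IsMaximalEmptyBall S p u c ρ)
    (h' : IsMaximalEmptyBall (F '' S) (F p) (imageNormal F p u) c' ρ')
    (hF : IsC11Diffeo F LF LDF) : ρ / (LF ^ 3 + ρ * LDF * LF ^ 2) ≤ ρ' := by
  rw [← EReal.coe_le_coe_iff, h'.radius_eq]
  exact hF.coe_le_projectionRange_image h.norm_eq_one h.radius_pos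
    (h.center_eq ▸ h.mem_closestPoints)

theorem div_radius_image_le (h : IsMaximalEmptyBall S p u c ρ)
    (h' : IsMaximalEmptyBall (F '' S) (F p) (imageNormal F p u) c' ρ')
    (hF : IsC11Diffeo F LF LDF) : ρ' / (LF ^ 3 + ρ' * LDF * LF ^ 2) ≤ ρ := by
  refine h'.div_le_radius_image ?_ hF.symm (c' := c)
  rwa [F.symm_image_image, F.symm_apply_apply, hF.imageNormal_symm p h.norm_eq_one]

theorem radius_image_le (h : IsMaximalEmptyBall S p u c ρ)
    (h' : IsMaximalEmptyBall (F '' S) (F p) (imageNormal F p u) c' ρ')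
    (hF : IsC11Diffeo F LF LDF) (hlt : ρ * LDF * LF ^ 2 < 1) :
    ρ' ≤ LF ^ 3 * ρ / (1 - ρ * LDF * LF ^ 2) := by
  have hle := h.div_radius_image_le h' hF
  have hρ' := h'.radius_pos
  have := nontrivial_of_norm_eq_one h.norm_eq_one
  have hLF := hF.one_le
  rw [div_le_iff₀ (by positivity)] at hle
  rw [le_div_iff₀ (sub_pos.2 hlt)]
  linarith

theorem dist_center_image_le (h : IsMaximalEmptyBall S p u c ρ)
    (h' : IsMaximalEmptyBall (F '' S) (F p) (imageNormal F p u) c' ρ')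
    (hF : IsC11Diffeo F LF LDF) (hρr : ρ ≤ r) (hρr' : ρ' ≤ r) (hε₁ : ‖F p - p‖ ≤ ε₁)
    (hε₂ : ‖fderiv ℝ F p - ContinuousLinearMap.id ℝ (EuclideanSpace ℝ (Fin d))‖ ≤ ε₂)
    (hε : ε₂ ≤ 1) : dist c c' ≤ distortionBound r LF LDF ε₁ ε₂ := by
  have := nontrivial_of_norm_eq_one h.norm_eq_one
  have hLF := hF.one_le
  have hρ := h.radius_pos
  have hρ' := h'.radius_pos
  have hr : 0 < r := hρ.trans_le hρr
  set M : ℝ := LF ^ 3 * (1 + 4 * r * LDF * LF ^ 2) with hM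
  have hM1 : 1 ≤ M := one_le_mul_of_one_le_of_one_le (one_le_pow₀ hLF)
    (le_add_of_nonneg_right (by positivity))
  have hdir : ‖ρ • u - ρ' • imageNormal F p u‖ ≤ r * √(1 + M ^ 2 - 2 * M * √(1 - ε₂ ^ 2)) :=
    norm_smul_sub_smul_le h.norm_eq_one h'.norm_eq_one hρ.le hρ'.le hρr hρr' hM1
      (le_mul_of_div_cube_add_le hρ.le hρr hρ'.le hLF LDF.coe_nonneg (h.div_le_radius_image h' hF))
      (le_mul_of_div_cube_add_le hρ'.le hρr' hρ.le hLF LDF.coe_nonneg (h.div_radius_image_le h' hF))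
      (hF.sqrt_one_sub_sq_le_inner_imageNormal h.norm_eq_one hε hε₂)
  calc dist c c' = ‖ρ • u - ρ' • imageNormal F p u - (F p - p)‖ := by
        rw [dist_eq_norm, h.center_eq, h'.center_eq]
        congr 1
        abel
    _ ≤ ‖ρ • u - ρ' • imageNormal F p u‖ + ‖F p - p‖ := norm_sub_le _ _
    _ ≤ 2 * r * √(1 + M ^ 2 - 2 * M * √(1 - ε₂ ^ 2)) + ε₁ := by
        gcongr
        exact hdir.trans (by gcongr; linarith)
    _ = distortionBound r LF LDF ε₁ ε₂ := by
        rw [distortionBound, hM]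
        ring_nf

theorem closedBall_inter_orthogonal (h : IsMaximalEmptyBall S p u c ρ) :
    closedBall c ρ ∩ (fun w => p + w) '' ((ℝ ∙ u)ᗮ : Set _) = {p} := by
  have hmem : ρ • u ∈ (ℝ ∙ u)ᗮᗮ := Submodule.le_orthogonal_orthogonal _
    (Submodule.smul_mem _ ρ (Submodule.mem_span_singleton_self u))
  have hinter := closedBall_inter_image_add_eq_singleton hmem p
  rwa [norm_smul_of_nonneg h.radius_pos.le, h.norm_eq_one, mul_one, ← h.center_eq] at hinter

theorem closedBall_inter_image_fderiv_orthogonal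
    (h' : IsMaximalEmptyBall (F '' S) (F p) (imageNormal F p u) c' ρ')
    (hF : IsC11Diffeo F LF LDF) (hu : u ≠ 0) :
    closedBall c' ρ' ∩ (fun v => F p + fderiv ℝ F p v) '' ((ℝ ∙ u)ᗮ : Set _) = {F p} := by
  have hinter := h'.closedBall_inter_orthogonal
  rwa [← hF.map_orthogonal p hu, Submodule.map_coe, image_image] at hinter

end IsMaximalEmptyBall

theorem exists_mem_closure_medialAxis_image_dist_le (hS : IsClosed S)
    (hSball : S ⊆ closedBall o r) (hsphere : sphere o r ⊆ S) (hF : IsC11Diffeo F LF LDF)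
    (hFsphere : F '' sphere o r = sphere o r) (hε₁ : ∀ x, ‖F x - x‖ ≤ ε₁)
    (hε₂ : ∀ x, ‖fderiv ℝ F x - ContinuousLinearMap.id ℝ (EuclideanSpace ℝ (Fin d))‖ ≤ ε₂)
    (hε : ε₂ ≤ 1) (hc : c ∈ medialAxis S) :
    ∃ c' ∈ closure (medialAxis (F '' S)), dist c c' ≤ distortionBound r LF LDF ε₁ ε₂ := by
  obtain ⟨p, hp⟩ := hc.nonempty
  have hcr := medialAxis_subset_ball hSball hsphere hc
  have h := isMaximalEmptyBall_of_mem_medialAxis hc hp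
  obtain ⟨c', ρ', h', hρr'⟩ := h.exists_image hF hFsphere hsphere hcr
  exact ⟨c', h'.center_mem_closure_medialAxis (hF.isClosed_image hS),
    h.dist_center_image_le h' hF (h.radius_le hsphere hcr) hρr' (hε₁ p) (hε₂ p) hε⟩

theorem exists_mem_closure_medialAxis_dist_image_le (hS : IsClosed S)
    (hSball : S ⊆ closedBall o r) (hsphere : sphere o r ⊆ S) (hF : IsC11Diffeo F LF LDF)
    (hFsphere : F '' sphere o r = sphere o r) (hε₁ : ∀ x, ‖F x - x‖ ≤ ε₁)
    (hε₂ : ∀ x, ‖fderiv ℝ F x - ContinuousLinearMap.id ℝ (EuclideanSpace ℝ (Fin d))‖ ≤ ε₂)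
    (hε : ε₂ ≤ 1) (hc' : c' ∈ medialAxis (F '' S)) :
    ∃ c ∈ closure (medialAxis S), dist c c' ≤ distortionBound r LF LDF ε₁ ε₂ := by
  obtain ⟨q, hq⟩ := hc'.nonempty
  obtain ⟨p, rfl⟩ := F.surjective q
  have hsphere' : sphere o r ⊆ F '' S := hFsphere ▸ image_mono hsphere
  have hFsphere' : F.symm '' sphere o r = sphere o r :=
    (congrArg _ hFsphere).symm.trans (F.symm_image_image _)
  have hcr := medialAxis_subset_ball
    ((image_mono hSball).trans (hF.image_closedBall_subset hFsphere)) hsphere' hc'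
  have h' := isMaximalEmptyBall_of_mem_medialAxis hc' hq
  obtain ⟨c, ρ, h, hρr⟩ := h'.exists_image hF.symm hFsphere' hsphere' hcr
  have hnormal := hF.symm.imageNormal_symm (F p) h'.norm_eq_one
  rw [F.symm_symm, F.symm_apply_apply] at hnormal
  rw [F.symm_image_image, F.symm_apply_apply] at h
  rw [← hnormal] at h'
  exact ⟨c, h.center_mem_closure_medialAxis hS,
    h.dist_center_image_le h' hF hρr (h'.radius_le hsphere' hcr) (hε₁ p) (hε₂ p) hε⟩

theorem hausdorffEDist_medialAxis_image_le (hS : IsClosed S)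
    (hSball : S ⊆ closedBall o r) (hsphere : sphere o r ⊆ S) (hF : IsC11Diffeo F LF LDF)
    (hFsphere : F '' sphere o r = sphere o r) (hε₁ : ∀ x, ‖F x - x‖ ≤ ε₁)
    (hε₂ : ∀ x, ‖fderiv ℝ F x - ContinuousLinearMap.id ℝ (EuclideanSpace ℝ (Fin d))‖ ≤ ε₂)
    (hε : ε₂ ≤ 1) :
    hausdorffEDist (medialAxis S) (medialAxis (F '' S)) ≤
      ENNReal.ofReal (distortionBound r LF LDF ε₁ ε₂) := by
  refine hausdorffEDist_le_of_infEDist (fun c hc => ?_) (fun c' hc' => ?_)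
  · obtain ⟨c', hc', hle⟩ := exists_mem_closure_medialAxis_image_dist_le hS hSball hsphere hF
      hFsphere hε₁ hε₂ hε hc
    exact infEDist_le_ofReal_of_mem_closure hc' hle
  · obtain ⟨c, hc, hle⟩ := exists_mem_closure_medialAxis_dist_image_le hS hSball hsphere hF
      hFsphere hε₁ hε₂ hε hc'
    exact infEDist_le_ofReal_of_mem_closure hc ((dist_comm c' c).trans_le hle)

end Image

theorem mainTheorem1_general {d : ℕ} (S : Set (EuclideanSpace ℝ (Fin d))) (hS : IsClosed S)
    (o : EuclideanSpace ℝ (Fin d)) (r : ℝ)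
    (hSball : S ⊆ closedBall o r) (hsphere : sphere o r ⊆ S)
    (F : EuclideanSpace ℝ (Fin d) ≃ EuclideanSpace ℝ (Fin d)) (LF LDF : ℝ≥0)
    (hF : IsC11Diffeo F LF LDF) (hFsphere : F '' sphere o r = sphere o r) :
    (∀ c ∈ medialAxis S, ∀ p ∈ closestPoints S c, ∀ (ρ : ℝ) (u u' : EuclideanSpace ℝ (Fin d)),
      ρ = ‖c - p‖ → u = ‖c - p‖⁻¹ • (c - p) → u' = imageNormal F p u →
        IsMaximalEmptyBall S p u c ρ ∧
        ‖u'‖ = 1 ∧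
        Submodule.map (fderiv ℝ F p).toLinearMap (ℝ ∙ u)ᗮ = (ℝ ∙ u')ᗮ ∧
        (∀ᶠ t : ℝ in 𝓝[>] 0, F p + t • u' ∈ F '' ball c ρ) ∧
        ∃ (c' : EuclideanSpace ℝ (Fin d)) (ρ' : ℝ),
          IsMaximalEmptyBall (F '' S) (F p) u' c' ρ' ∧
          closedBall c' ρ' ∩ ((fun v => F p + fderiv ℝ F p v) '' ((ℝ ∙ u)ᗮ : Set _)) = {F p} ∧
          ρ / ((LF : ℝ) ^ 3 + ρ * LDF * LF ^ 2) ≤ ρ' ∧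
          (ρ * LDF * LF ^ 2 < 1 → ρ' ≤ (LF : ℝ) ^ 3 * ρ / (1 - ρ * LDF * LF ^ 2))) ∧
    (∀ ε₁ ε₂ : ℝ, (∀ x, ‖F x - x‖ ≤ ε₁) →
      (∀ x, ‖fderiv ℝ F x - ContinuousLinearMap.id ℝ (EuclideanSpace ℝ (Fin d))‖ ≤ ε₂) →
      ε₂ ≤ 1 →
        (∀ c ∈ medialAxis S, ∀ p ∈ closestPoints S c, ∀ u u' : EuclideanSpace ℝ (Fin d),
          u = ‖c - p‖⁻¹ • (c - p) → u' = imageNormal F p u →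
            ‖axisProjection S p u - axisProjection (F '' S) (F p) u'‖
              ≤ distortionBound r LF LDF ε₁ ε₂) ∧
        hausdorffEDist (medialAxis S) (medialAxis (F '' S))
          ≤ ENNReal.ofReal (distortionBound r LF LDF ε₁ ε₂) ∧
        hausdorffEDist (closure (medialAxis S)) (closure (medialAxis (F '' S)))
          ≤ ENNReal.ofReal (distortionBound r LF LDF ε₁ ε₂)) := by
  refine ⟨?_, fun ε₁ ε₂ hε₁ hε₂ hε => ⟨?_, ?_⟩⟩
  · rintro c hc p hp ρ u u' rfl rfl rfl
    have h := isMaximalEmptyBall_of_mem_medialAxis hc hp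
    have hu := ne_zero_of_norm_eq_one h.norm_eq_one
    obtain ⟨c', ρ', h', -⟩ :=
      h.exists_image hF hFsphere hsphere (medialAxis_subset_ball hSball hsphere hc)
    refine ⟨h, hF.norm_imageNormal p hu, hF.map_orthogonal p hu, ?_, c', ρ', h',
      h'.closedBall_inter_image_fderiv_orthogonal hF hu, h.div_le_radius_image h' hF,
      h.radius_image_le h' hF⟩
    have hinside := hF.eventually_mem_image_ball p h.norm_eq_one h.radius_pos
    rwa [← h.center_eq] at hinside
  · rintro c hc p hp u u' rfl rfl
    have hcr := medialAxis_subset_ball hSball hsphere hc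
    have h := isMaximalEmptyBall_of_mem_medialAxis hc hp
    obtain ⟨c', ρ', h', hρr'⟩ := h.exists_image hF hFsphere hsphere hcr
    have hle := h.dist_center_image_le h' hF (h.radius_le hsphere hcr) hρr' (hε₁ p) (hε₂ p) hε
    rwa [← h.axisProjection_eq, ← h'.axisProjection_eq, dist_eq_norm] at hle
  · rw [hausdorffEDist_closure_left, hausdorffEDist_closure_right, and_self]
    exact hausdorffEDist_medialAxis_image_le hS hSball hsphere hF hFsphere hε₁ hε₂ hε

theorem mainTheorem1 {d : ℕ} (S : Set (EuclideanSpace ℝ (Fin d))) (hS : IsClosed S)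
    (o : EuclideanSpace ℝ (Fin d)) (r : ℝ) (hr : 0 < r)
    (hSball : S ⊆ closedBall o r) (hsphere : sphere o r ⊆ S)
    (F : EuclideanSpace ℝ (Fin d) ≃ EuclideanSpace ℝ (Fin d)) (LF LDF : ℝ≥0)
    (hF : IsC11Diffeo F LF LDF) (hFsphere : F '' sphere o r = sphere o r) :
    -- existence of the maximal empty ball of the image, and the bounds on its radius
    (∀ c ∈ medialAxis S, ∀ p ∈ closestPoints S c, ∀ (ρ : ℝ) (u u' : EuclideanSpace ℝ (Fin d)),
      ρ = ‖c - p‖ → u = ‖c - p‖⁻¹ • (c - p) → u' = imageNormal F p u →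
        IsMaximalEmptyBall S p u c ρ ∧
        -- `u'` is the unit vector orthogonal to `D_pF(T)`, where `T = uᗮ`, that points inside
        -- the image of the ball
        ‖u'‖ = 1 ∧
        Submodule.map (fderiv ℝ F p).toLinearMap (ℝ ∙ u)ᗮ = (ℝ ∙ u')ᗮ ∧
        (∀ᶠ t : ℝ in 𝓝[>] 0, F p + t • u' ∈ F '' ball c ρ) ∧
        ∃ (c' : EuclideanSpace ℝ (Fin d)) (ρ' : ℝ),
          IsMaximalEmptyBall (F '' S) (F p) u' c' ρ' ∧
          -- tangency to the affine hyperplane `F(p) + D_pF(T)`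
          closedBall c' ρ' ∩ ((fun v => F p + fderiv ℝ F p v) '' ((ℝ ∙ u)ᗮ : Set _)) = {F p} ∧
          ρ / ((LF : ℝ) ^ 3 + ρ * LDF * LF ^ 2) ≤ ρ' ∧
          (ρ * LDF * LF ^ 2 < 1 → ρ' ≤ (LF : ℝ) ^ 3 * ρ / (1 - ρ * LDF * LF ^ 2))) ∧
    -- the distance estimates
    (∀ ε₁ ε₂ : ℝ, (∀ x, ‖F x - x‖ ≤ ε₁) →
      (∀ x, ‖fderiv ℝ F x - ContinuousLinearMap.id ℝ (EuclideanSpace ℝ (Fin d))‖ ≤ ε₂) →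
      ε₂ < 1 → r * LDF * LF ^ 2 ≤ 1 / 2 →
        (∀ c ∈ medialAxis S, ∀ p ∈ closestPoints S c, ∀ u u' : EuclideanSpace ℝ (Fin d),
          u = ‖c - p‖⁻¹ • (c - p) → u' = imageNormal F p u →
            ‖axisProjection S p u - axisProjection (F '' S) (F p) u'‖
              ≤ distortionBound r LF LDF ε₁ ε₂) ∧
        hausdorffEDist (medialAxis S) (medialAxis (F '' S))
          ≤ ENNReal.ofReal (distortionBound r LF LDF ε₁ ε₂) ∧
        hausdorffEDist (closure (medialAxis S)) (closure (medialAxis (F '' S)))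
          ≤ ENNReal.ofReal (distortionBound r LF LDF ε₁ ε₂)) := by
  have h := mainTheorem1_general S hS o r hSball hsphere F LF LDF hF hFsphere
  exact ⟨h.1, fun ε₁ ε₂ hε₁ hε₂ hε _ => h.2 ε₁ ε₂ hε₁ hε₂ hε.le⟩
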